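/- **Theorem (Affine compactness).** Every affinely satisfiable theory in affine integration logic $\mathrm{AL}_{\int}$ is satisfiable. Here the notions are as follows. A *Lipschitz language* $L$ consists of constant, function and relation symbols, where each function symbol $F$ and each relation symbol $R$ has a Lipschitz constant $\lambda_F,\lambda_R\ge 0$; the metric symbol $\rho$ and the charge symbol $\mu$ are logical symbols. An *$L$-structure* is a complete metric space $(M,\rho)$ with $\rho\le 1$, together with an element $c^M\in M$ for each constant symbol $c$, a $\lambda_F$-Lipschitz function $F^M:M^n\to M$ for each $n$-ary function symbol $F$ and a $\lambda_R$-Lipschitz function $R^M:M^n\to[0,1]$ for each $n$-ary relation symbol $R$ (where $M^n$ carries the metric $\sum_i\rho(a_i,b_i)$), and a regular Borel probability charge $\mu$ on $M$, i.e. a finitely additive function $\mu\ge 0$ with $\mu(M)=1$ on the Boolean algebra $\mathcal A(M)$ generated by the open sets such that, for all $A\in\mathcal A(M)$, $\mu(A)=\sup\{\mu(F):F\subseteq A\text{ closed}\}=\inf\{\mu(G):G\supseteq A\text{ open}\}$. *Formulas* are built from the atomic formulas $1$, $R(t_1,\dots,t_n)$ and $\rho(t_1,t_2)$ (with $t_i$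 terms) by $\phi+\psi$, $r\phi$ ($r\in\mathbb R$), $\inf_x\phi$, $\sup_x\phi$ and $\int\phi\,dx$; they are interpreted in a structure $M$ as real-valued functions in the obvious way, with $\inf_x$ and $\sup_x$ taken over $M$ and $\big(\int\phi\,dx\big)^M=\int\phi^M(x)\,d\mu(x)$. *Sentences* are formulas without free variables. A *theory* is a set of conditions $\phi\leqslant\psi$ with $\phi,\psi$ sentences; it is *satisfiable* if there is an $L$-structure $M$ with $\phi^M\le\psi^M$ for each $\phi\leqslant\psi$ in the theory. A theory $T$ is *affinely satisfiable* if for all conditions $\phi_1\leqslant\psi_1,\dots,\phi_k\leqslant\psi_k$ in $T$ and all reals $r_1,\dots,r_k\ge 0$ the single condition $\sum_i r_i\phi_i\leqslant\sum_i r_i\psi_i$ is satisfiable. -/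

import Mathlib

open scoped NNReal

universe u v w

noncomputable section

namespace AffineIntegration

/-! ### Borel charges and integration against a charge -/

/-- The Borel algebra of a (pseudo)metric space: the Boolean algebra of sets generated by the
open sets (only finite unions, no countable ones). -/
def borelAlgebra (M : Type w) [PseudoMetricSpace M] : Set (Set M) :=
  MeasureTheory.generateSetAlgebra {U : Set M | IsOpen U}

/-- A regular Borel probability charge: a finitely additive `μ ≥ 0` on the Borel algebra with
`μ M = 1`, inner regular for closed sets and outer regular for open sets.  (Closed and open sets
belong to the Borel algebra.  The values of `μ` outside the Borel algebra carry no meaning and are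
never used.) -/
structure RegularBorelCharge (M : Type w) [PseudoMetricSpace M] where
  /-- the underlying finitely additive set function -/
  μ : MeasureTheory.AddContent ℝ (borelAlgebra M)
  nonneg : ∀ A ∈ borelAlgebra M, 0 ≤ μ A
  univ_eq_one : μ Set.univ = 1
  inner_regular : ∀ A ∈ borelAlgebra M, IsLUB {r : ℝ | ∃ F ⊆ A, IsClosed F ∧ μ F = r} (μ A)
  outer_regular : ∀ A ∈ borelAlgebra M, IsGLB {r : ℝ | ∃ G ⊇ A, IsOpen G ∧ μ G = r} (μ A)

/-- The integral of a bounded function against a Borel charge: the supremum of the integrals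
`∑ i, c i * μ (A i)` of the step functions `∑ i, c i • 1_{A i}`, with `A i` in the Borel
algebra, that lie below `f`.  For an integrable `f` (in particular for every bounded continuous
`f`) this is the integral, that is, it is equal to the infimum of the integrals of the step
functions above `f`. -/
def RegularBorelCharge.integral {M : Type w} [PseudoMetricSpace M] (ν : RegularBorelCharge M)
    (f : M → ℝ) : ℝ :=
  sSup {r : ℝ | ∃ (k : ℕ) (c : Fin k → ℝ) (A : Fin k → Set M),
    (∀ i, A i ∈ borelAlgebra M) ∧
    (∀ x, ∑ i, (A i).indicator (fun _ => c i) x ≤ f x) ∧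
    r = ∑ i, c i * ν.μ (A i)}

/-! ### Syntax -/

/-- A Lipschitz language: function and relation symbols of all finite arities (constant symbols
are the function symbols of arity `0`), each with a Lipschitz constant.  The metric symbol, with
constant `1`, and the charge symbol are logical symbols. -/
structure LipschitzLanguage extends FirstOrder.Language.{u, v} where
  /-- Lipschitz constants of the function symbols -/
  funLip : ∀ {n : ℕ}, Functions n → ℝ≥0
  /-- Lipschitz constants of the relation symbols -/
  relLip : ∀ {n : ℕ}, Relations n → ℝ≥0

/-- Formulas of affine integration logic whose free variables are among `x₀, …, x_{n-1}`.
As for Mathlib's first-order formulas, a quantifier applied to a formula in the variables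
`x₀, …, xₙ` binds the last variable `xₙ`. -/
inductive Formula (L : LipschitzLanguage.{u, v}) : ℕ → Type (max u v)
  /-- the atomic formula `1` -/
  | one {n : ℕ} : Formula L n
  /-- the atomic formula `R(t₁, …, t_k)` -/
  | rel {n k : ℕ} (R : L.Relations k) (t : Fin k → L.toLanguage.Term (Fin n)) : Formula L n
  /-- the atomic formula `ρ(t₁, t₂)` -/
  | rho {n : ℕ} (t₁ t₂ : L.toLanguage.Term (Fin n)) : Formula L n
  /-- the formula `φ + ψ` -/
  | add {n : ℕ} (φ ψ : Formula L n) : Formula L n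
  /-- the formula `r φ` -/
  | smul {n : ℕ} (r : ℝ) (φ : Formula L n) : Formula L n
  /-- the formula `inf_y φ` -/
  | inf {n : ℕ} (φ : Formula L (n + 1)) : Formula L n
  /-- the formula `sup_y φ` -/
  | sup {n : ℕ} (φ : Formula L (n + 1)) : Formula L n
  /-- the formula `∫ φ dy` -/
  | int {n : ℕ} (φ : Formula L (n + 1)) : Formula L n

/-- A sentence is a formula without free variables. -/
abbrev Sentence (L : LipschitzLanguage.{u, v}) : Type (max u v) := Formula L 0

/-- The formula `∑ i, r i • φ i`; the empty sum is `0 • 1`. -/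
def Formula.linComb {L : LipschitzLanguage.{u, v}} {n : ℕ} :
    (k : ℕ) → (Fin k → ℝ) → (Fin k → Formula L n) → Formula L n
  | 0, _, _ => .smul 0 .one
  | k + 1, r, φ => .add (linComb k (fun i => r i.castSucc) (fun i => φ i.castSucc))
      (.smul (r (Fin.last k)) (φ (Fin.last k)))

/-- A (closed) condition `φ ≤ ψ` between sentences. -/
structure Condition (L : LipschitzLanguage.{u, v}) : Type (max u v) where
  /-- the left-hand side -/
  lhs : Sentence L
  /-- the right-hand side -/
  rhs : Sentence L

/-- A theory is a set of closed conditions. -/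
abbrev Theory (L : LipschitzLanguage.{u, v}) : Type (max u v) := Set (Condition L)

/-- The condition `∑ i, r i • φ i ≤ ∑ i, r i • ψ i` formed from conditions `φ i ≤ ψ i`. -/
def Condition.linComb {L : LipschitzLanguage.{u, v}} (k : ℕ) (r : Fin k → ℝ)
    (S : Fin k → Condition L) : Condition L where
  lhs := Formula.linComb k r (fun i => (S i).lhs)
  rhs := Formula.linComb k r (fun i => (S i).rhs)

/-! ### Semantics -/

/-- A prestructure on a pseudometric space `M`.  The Lipschitz conditions refer to the
pseudometric `∑ i, ρ (a i) (b i)` on `Mⁿ`; all relations, including `ρ`, have values in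
`[0, 1]`. -/
structure Prestructure (L : LipschitzLanguage.{u, v}) (M : Type w) [PseudoMetricSpace M] where
  dist_le_one : ∀ x y : M, dist x y ≤ 1
  /-- interpretation of the function symbols -/
  funMap : ∀ {n : ℕ}, L.Functions n → (Fin n → M) → M
  funMap_lipschitz : ∀ {n : ℕ} (F : L.Functions n) (a b : Fin n → M),
    dist (funMap F a) (funMap F b) ≤ L.funLip F * ∑ i, dist (a i) (b i)
  /-- interpretation of the relation symbols -/
  relMap : ∀ {n : ℕ}, L.Relations n → (Fin n → M) → ℝ
  relMap_mem : ∀ {n : ℕ} (R : L.Relations n) (a : Fin n → M), relMap R a ∈ Set.Icc (0 : ℝ) 1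
  relMap_lipschitz : ∀ {n : ℕ} (R : L.Relations n) (a b : Fin n → M),
    |relMap R a - relMap R b| ≤ L.relLip R * ∑ i, dist (a i) (b i)
  /-- interpretation of the charge symbol -/
  charge : RegularBorelCharge M

namespace Prestructure

variable {L : LipschitzLanguage.{u, v}} {M : Type w} [PseudoMetricSpace M]

/-- The value `t^M(a)` of a term. -/
def termVal (S : Prestructure L M) {n : ℕ} (a : Fin n → M) : L.toLanguage.Term (Fin n) → M
  | .var i => a i
  | .func F t => S.funMap F (fun i => termVal S a (t i))

/-- The value `φ^M(a)` of a formula; `Fin.snoc a b` is the tuple `(a, b)`. -/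
def val (S : Prestructure L M) : {n : ℕ} → Formula L n → (Fin n → M) → ℝ
  | _, .one, _ => 1
  | _, .rel R t, a => S.relMap R (fun i => S.termVal a (t i))
  | _, .rho t₁ t₂, a => dist (S.termVal a t₁) (S.termVal a t₂)
  | _, .add φ ψ, a => val S φ a + val S ψ a
  | _, .smul r φ, a => r * val S φ a
  | _, .inf φ, a => ⨅ b : M, val S φ (Fin.snoc (α := fun _ => M) a b)
  | _, .sup φ, a => ⨆ b : M, val S φ (Fin.snoc (α := fun _ => M) a b)
  | _, .int φ, a => S.charge.integral (fun b => val S φ (Fin.snoc (α := fun _ => M) a b))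

/-- The value `σ^M` of a sentence. -/
def sentenceVal (S : Prestructure L M) (σ : Sentence L) : ℝ := S.val σ Fin.elim0

/-- `M` satisfies the condition `φ ≤ ψ`. -/
def Satisfies (S : Prestructure L M) (C : Condition L) : Prop :=
  S.sentenceVal C.lhs ≤ S.sentenceVal C.rhs

end Prestructure

/-- A theory is satisfiable if some structure, that is, some prestructure whose pseudometric is a
complete metric, satisfies all of its conditions.  The universe `w` bounds the size of the
structures. -/
def Theory.Satisfiable {L : LipschitzLanguage.{u, v}} (T : Theory L) : Prop :=
  ∃ (M : Type w) (_ : MetricSpace M) (_ : CompleteSpace M) (S : Prestructure L M),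
    ∀ C ∈ T, S.Satisfies C

/-- A single closed condition is satisfiable if some structure satisfies it. -/
def Condition.Satisfiable {L : LipschitzLanguage.{u, v}} (C : Condition L) : Prop :=
  ∃ (M : Type w) (_ : MetricSpace M) (_ : CompleteSpace M) (S : Prestructure L M),
    S.Satisfies C

/-- A theory is affinely satisfiable if each nonnegative combination of finitely many of its
conditions is satisfiable. -/
def Theory.AffinelySatisfiable {L : LipschitzLanguage.{u, v}} (T : Theory L) : Prop :=
  ∀ (k : ℕ) (r : Fin k → ℝ) (S : Fin k → Condition L),
    (∀ i, 0 ≤ r i) → (∀ i, S i ∈ T) →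
      Condition.Satisfiable.{u, v, w} (Condition.linComb k r S)

end AffineIntegration

end

/-!
The model is an *ultramean* of structures: an analogue of the ultraproduct in which the ultrafilter
on the index set is replaced by a mean `Λ`, that is, a positive normalized linear functional on
bounded functions (integration against a finitely additive probability).

**Choice of the mean.** Index by the satisfiable conditions, choosing a structure for each. By
affine satisfiability, no nonnegative combination of the functions `rhs - lhs`, for conditions
in the theory, has a negative supremum over the index set; the Riesz extension theorem
(`exists_mean_nonneg`) then gives a mean which is nonnegative on all these functions.

**Transfer.** On the product of the structures take the pseudometric `Λ (dist (a i) (b i))`, and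
complete it. A mean commutes with linear combinations, and also with `inf` and `sup`, because the
coordinates of a point can be chosen independently (`Ultramean.iInf_mean`). For the integral, a
charge is needed for which a function `b ↦ Λ (f i (b i))` has integral `Λ (∫ f i)`. These
requirements are linear in `f`, and they are consistent with positivity, again because the
coordinates can be chosen independently: so a second application of Riesz extension gives a mean `J`
on the product with these values (`Ultramean.exists_mean_integral`).

**From the mean to a charge.** By Alexandrov's representation theorem (`Mean.integral_charge`), a
mean on a metric space agrees on bounded continuous functions with integration against a regular
Borel charge: the value on closed sets is the infimum over the continuous functions above the
indicator, arbitrary sets are approximated from inside by closed sets, and the sets satisfying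
Carathéodory's condition form an algebra which contains the closed sets. Since formulas are
bounded and Lipschitz, this charge realizes `J` on them, and every formula takes in the ultramean
the mean of its values (`Ultramean.exists_prestructure`).
-/

noncomputable section

namespace AffineIntegration

open Set MeasureTheory

/-! ### Step functions and integration against a charge -/

section Integral

variable {M : Type*} [PseudoMetricSpace M]

lemma isSetAlgebra_borelAlgebra : IsSetAlgebra (borelAlgebra M) :=
  isSetAlgebra_generateSetAlgebra

lemma mem_borelAlgebra_of_isOpen {U : Set M} (hU : IsOpen U) : U ∈ borelAlgebra M :=
  self_subset_generateSetAlgebra hU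

lemma mem_borelAlgebra_of_isClosed {F : Set M} (hF : IsClosed F) : F ∈ borelAlgebra M := by
  simpa using isSetAlgebra_borelAlgebra.compl_mem (mem_borelAlgebra_of_isOpen hF.isOpen_compl)

namespace RegularBorelCharge

lemma nonempty (ν : RegularBorelCharge M) : Nonempty M := by
  by_contra h
  rw [not_nonempty_iff] at h
  have h1 := ν.univ_eq_one
  rw [univ_eq_empty_iff.2 h, addContent_empty] at h1
  exact zero_ne_one h1

variable (ν : RegularBorelCharge M)

lemma inter_add_sdiff {A B : Set M} (hA : A ∈ borelAlgebra M) (hB : B ∈ borelAlgebra M) :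
    ν.μ (B ∩ A) + ν.μ (B \ A) = ν.μ B := by
  have hC := isSetAlgebra_borelAlgebra (M := M)
  rw [← addContent_union hC.isSetRing (hC.inter_mem hB hA) (hC.sdiff_mem hB hA)
    disjoint_sdiff_inter.symm, inter_union_sdiff]

/-- Positivity of integration, localized to a set `B` so that an induction on the number of
steps works: the last step `A j` splits `B` into two pieces on each of which its indicator is
constant. -/
lemma mul_le_sum {ι : Type*} (s : Finset ι) (c : ι → ℝ) (A : ι → Set M)
    (hA : ∀ i, A i ∈ borelAlgebra M) :
    ∀ {B : Set M}, B ∈ borelAlgebra M → ∀ t : ℝ,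
      (∀ x ∈ B, t ≤ ∑ i ∈ s, (A i).indicator (fun _ => c i) x) →
      t * ν.μ B ≤ ∑ i ∈ s, c i * ν.μ (B ∩ A i) := by
  have hC := isSetAlgebra_borelAlgebra (M := M)
  classical
  induction s using Finset.induction with
  | empty =>
    intro B hB t h
    rcases B.eq_empty_or_nonempty with rfl | ⟨x, hx⟩
    · simp
    · have := h x hx
      simp only [Finset.sum_empty] at this ⊢
      exact mul_nonpos_of_nonpos_of_nonneg this (ν.nonneg B hB)
  | insert j s hj ih =>
    intro B hB t h
    have hin := hC.inter_mem hB (hA j)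
    have hout := hC.sdiff_mem hB (hA j)
    have h1 := ih hin (t - c j) (by
      intro x hx
      have := h x hx.1
      rw [Finset.sum_insert hj, indicator_of_mem hx.2] at this
      linarith)
    have h2 := ih hout t (by
      intro x hx
      have := h x hx.1
      rwa [Finset.sum_insert hj, indicator_of_notMem hx.2, zero_add] at this)
    have h3 : ∀ i, ν.μ (B ∩ A i) = ν.μ (B ∩ A j ∩ A i) + ν.μ ((B \ A j) ∩ A i) := by
      intro i
      rw [← ν.inter_add_sdiff (hA j) (hC.inter_mem hB (hA i))]
      congr 2 <;> (ext; simp; tauto)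
    rw [Finset.sum_insert hj]
    simp only [h3, mul_add, Finset.sum_add_distrib]
    have h4 := ν.inter_add_sdiff (hA j) hB
    have h5 : t * ν.μ B = t * ν.μ (B ∩ A j) + t * ν.μ (B \ A j) := by rw [← h4]; ring
    rw [sub_mul] at h1
    have h6 : c j * ν.μ (B ∩ A j ∩ A j) + c j * ν.μ ((B \ A j) ∩ A j) = c j * ν.μ (B ∩ A j) := by
      rw [← mul_add, ← h3 j]
    linarith

/-- `g` is a step function over the Borel algebra, and `r` is its integral computed from some
presentation `g = ∑ i, c i • 1_{A i}`. -/
def IsStep (g : M → ℝ) (r : ℝ) : Prop :=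
  ∃ (k : ℕ) (c : Fin k → ℝ) (A : Fin k → Set M), (∀ i, A i ∈ borelAlgebra M) ∧
    (g = fun x => ∑ i, (A i).indicator (fun _ => c i) x) ∧ r = ∑ i, c i * ν.μ (A i)

variable {ν}

lemma IsStep.indicator {A : Set M} (hA : A ∈ borelAlgebra M) (c : ℝ) :
    ν.IsStep (A.indicator fun _ => c) (c * ν.μ A) :=
  ⟨1, fun _ => c, fun _ => A, fun _ => hA, by simp, by simp⟩

lemma IsStep.const (c : ℝ) : ν.IsStep (fun _ => c) c := by
  have := IsStep.indicator (ν := ν) (A := univ) (isSetAlgebra_borelAlgebra.univ_mem) c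
  simpa [ν.univ_eq_one] using this

lemma IsStep.add {g h : M → ℝ} {r s : ℝ} (hg : ν.IsStep g r) (hh : ν.IsStep h s) :
    ν.IsStep (fun x => g x + h x) (r + s) := by
  obtain ⟨k, c, A, hA, rfl, rfl⟩ := hg
  obtain ⟨l, d, B, hB, rfl, rfl⟩ := hh
  refine ⟨k + l, Fin.append c d, Fin.append A B, ?_, ?_, ?_⟩
  · intro i
    refine Fin.addCases (fun i => ?_) (fun i => ?_) i
    · simpa using hA i
    · simpa using hB i
  · funext x
    simp [Fin.sum_univ_add]
  · simp [Fin.sum_univ_add]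

lemma IsStep.const_mul {g : M → ℝ} {r : ℝ} (hg : ν.IsStep g r) (a : ℝ) :
    ν.IsStep (fun x => a * g x) (a * r) := by
  obtain ⟨k, c, A, hA, rfl, rfl⟩ := hg
  refine ⟨k, fun i => a * c i, A, hA, ?_, ?_⟩
  · funext x
    simp only [Finset.mul_sum, indicator_const_mul]
  · simp only [Finset.mul_sum, mul_assoc]

lemma IsStep.sum {ι : Type*} (s : Finset ι) {g : ι → M → ℝ} {r : ι → ℝ}
    (h : ∀ i ∈ s, ν.IsStep (g i) (r i)) :
    ν.IsStep (fun x => ∑ i ∈ s, g i x) (∑ i ∈ s, r i) := by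
  classical
  induction s using Finset.induction with
  | empty => simpa using IsStep.const (ν := ν) 0
  | insert j s hj ih =>
    simp only [Finset.sum_insert hj]
    exact (h j (Finset.mem_insert_self _ _)).add
      (ih fun i hi => h i (Finset.mem_insert_of_mem hi))

lemma IsStep.nonneg {g : M → ℝ} {r : ℝ} (hg : ν.IsStep g r) (h : ∀ x, 0 ≤ g x) : 0 ≤ r := by
  obtain ⟨k, c, A, hA, rfl, rfl⟩ := hg
  have := ν.mul_le_sum Finset.univ c A hA isSetAlgebra_borelAlgebra.univ_mem 0
    (fun x _ => h x)
  simpa using this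

lemma IsStep.mono {g h : M → ℝ} {r s : ℝ} (hg : ν.IsStep g r) (hh : ν.IsStep h s)
    (hle : ∀ x, g x ≤ h x) : r ≤ s := by
  have := (hh.add (hg.const_mul (-1))).nonneg (fun x => by linarith [hle x])
  linarith

lemma integral_eq_sSup (f : M → ℝ) :
    ν.integral f = sSup {r : ℝ | ∃ g, ν.IsStep g r ∧ ∀ x, g x ≤ f x} := by
  unfold integral
  congr 1
  ext r
  constructor
  · rintro ⟨k, c, A, hA, hle, rfl⟩
    exact ⟨_, ⟨k, c, A, hA, rfl, rfl⟩, hle⟩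
  · rintro ⟨g, ⟨k, c, A, hA, rfl, rfl⟩, hle⟩
    exact ⟨k, c, A, hA, hle, rfl⟩

lemma IsStep.le_integral {f g : M → ℝ} {r B : ℝ} (hf : ∀ x, f x ≤ B) (hg : ν.IsStep g r)
    (h : ∀ x, g x ≤ f x) : r ≤ ν.integral f := by
  rw [integral_eq_sSup]
  refine le_csSup ⟨B, ?_⟩ ⟨g, hg, h⟩
  rintro s ⟨g', hg', h'⟩
  exact hg'.mono (IsStep.const B) fun x => (h' x).trans (hf x)

lemma IsStep.integral_le {f h : M → ℝ} {s B : ℝ} (hf : ∀ x, B ≤ f x) (hh : ν.IsStep h s)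
    (hle : ∀ x, f x ≤ h x) : ν.integral f ≤ s := by
  rw [integral_eq_sSup]
  refine csSup_le ⟨B, _, IsStep.const B, hf⟩ ?_
  rintro r ⟨g, hg, h'⟩
  exact hg.mono hh fun x => (h' x).trans (hle x)

end RegularBorelCharge

lemma sum_clip (n : ℕ) (t : ℝ) :
    ∑ k ∈ Finset.range n, max 0 (min 1 (t - k)) = max 0 (min (n : ℝ) t) := by
  induction n with
  | zero => simp
  | succ n ih =>
    have : (0 : ℝ) ≤ n := n.cast_nonneg
    rw [Finset.sum_range_succ, ih]
    push_cast
    simp only [max_def, min_def]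
    split_ifs <;> linarith

lemma le_sum_indicator_add_one {n : ℕ} {t : ℝ} (h0 : 0 ≤ t) (hn : t ≤ n) :
    t ≤ (∑ k ∈ Finset.range n, {s : ℝ | (k : ℝ) + 1 ≤ s}.indicator (fun _ => (1 : ℝ)) t) + 1 := by
  have h1 : t = ∑ k ∈ Finset.range n, max 0 (min 1 (t - k)) := by
    rw [sum_clip, min_eq_right hn, max_eq_right h0]
  have h2 : ∀ k : ℕ, max 0 (min 1 (t - k)) ≤
      {s : ℝ | (k : ℝ) ≤ s}.indicator (fun _ => (1 : ℝ)) t := by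
    intro k
    by_cases hk : (k : ℝ) ≤ t
    · rw [indicator_of_mem (by exact hk)]; simp
    · rw [indicator_of_notMem (by exact hk)]
      push Not at hk
      exact max_le le_rfl ((min_le_right _ _).trans (by linarith))
  calc t = _ := h1
    _ ≤ ∑ k ∈ Finset.range (n + 1), {s : ℝ | (k : ℝ) ≤ s}.indicator (fun _ => (1 : ℝ)) t := by
        refine (Finset.sum_le_sum fun k _ => h2 k).trans ?_
        refine Finset.sum_le_sum_of_subset_of_nonneg (by simp) fun i _ _ => ?_
        exact indicator_nonneg (fun _ _ => zero_le_one) _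
    _ ≤ _ := by
        rw [Finset.sum_range_succ']
        push_cast
        gcongr
        exact indicator_le_self' (fun _ _ => zero_le_one) t

namespace RegularBorelCharge

variable {ν : RegularBorelCharge M}

/-- Layer-cake approximation: a bounded continuous function lies within `δ` above a step function
built from its closed superlevel sets.  The last clause serves to compare the charge with a linear
functional `Φ` which dominates it on closed sets: the same slicing writes `f` as a sum of
continuous functions, each above the indicator of the corresponding superlevel set. -/
lemma exists_isStep_approx {f : M → ℝ} (hf : Continuous f) {B : ℝ} (hB : ∀ x, |f x| ≤ B)
    {δ : ℝ} (hδ : 0 < δ) :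
    ∃ g r, ν.IsStep g r ∧ (∀ x, g x ≤ f x) ∧ (∀ x, f x ≤ g x + δ) ∧
      ∀ Φ : (M → ℝ) →ₗ[ℝ] ℝ, Φ (fun _ => 1) = 1 →
        (∀ (F : Set M) (u : M → ℝ), IsClosed F → Continuous u → (∀ x, u x ∈ Icc (0 : ℝ) 1) →
          (∀ x ∈ F, u x = 1) → ν.μ F ≤ Φ u) → r ≤ Φ f := by
  obtain ⟨n, hn⟩ := exists_nat_ge (2 * B / δ)
  set t : M → ℝ := fun x => (f x + B) / δ with ht
  have htc : Continuous t := (hf.add continuous_const).div_const _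
  have ht0 : ∀ x, 0 ≤ t x := fun x =>
    div_nonneg (by linarith [(abs_le.1 (hB x)).1]) hδ.le
  have htn : ∀ x, t x ≤ n := fun x =>
    le_trans (by simp only [ht]; gcongr; linarith [(abs_le.1 (hB x)).2]) hn
  have hft : ∀ x, f x = -B + δ * t x := fun x => by simp only [ht]; field_simp; ring
  set F : ℕ → Set M := fun k => {x | (k : ℝ) + 1 ≤ t x} with hF
  have hFc : ∀ k, IsClosed (F k) := fun k => isClosed_le continuous_const htc
  have hind : ∀ k x, (F k).indicator (fun _ => (1 : ℝ)) x =
      {s : ℝ | (k : ℝ) + 1 ≤ s}.indicator (fun _ => (1 : ℝ)) (t x) := fun k x => rfl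
  refine ⟨fun x => -B + δ * ∑ k ∈ Finset.range n, (F k).indicator (fun _ => (1 : ℝ)) x,
    -B + δ * ∑ k ∈ Finset.range n, 1 * ν.μ (F k),
    (IsStep.const _).add ((IsStep.sum _ fun k _ =>
      IsStep.indicator (mem_borelAlgebra_of_isClosed (hFc k)) 1).const_mul δ), ?_, ?_, ?_⟩
  · intro x
    rw [hft x]
    beta_reduce
    gcongr
    have h1 : t x = ∑ k ∈ Finset.range n, max 0 (min 1 (t x - k)) := by
      rw [sum_clip, min_eq_right (htn x), max_eq_right (ht0 x)]
    rw [h1]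
    refine Finset.sum_le_sum fun k _ => ?_
    by_cases hk : x ∈ F k
    · rw [indicator_of_mem hk]
      have hk' : (k : ℝ) + 1 ≤ t x := hk
      exact le_max_of_le_right (le_min le_rfl (by linarith))
    · rw [indicator_of_notMem hk]
      exact le_max_left _ _
  · intro x
    rw [hft x, add_assoc]
    gcongr
    have := le_sum_indicator_add_one (ht0 x) (htn x)
    simp only [hind]
    nlinarith
  · intro Φ hΦ1 hΦ
    have h1 : f = (-B) • (fun _ => (1 : ℝ)) +
        δ • ∑ k ∈ Finset.range n, fun x => max 0 (min 1 (t x - k)) := by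
      funext x
      simp only [Pi.add_apply, Pi.smul_apply, Finset.sum_apply, smul_eq_mul]
      rw [sum_clip, min_eq_right (htn x), max_eq_right (ht0 x), hft x, mul_one]
    rw [h1, map_add, map_smul, map_smul, map_sum, hΦ1, smul_eq_mul, smul_eq_mul, mul_one]
    refine add_le_add le_rfl (mul_le_mul_of_nonneg_left (Finset.sum_le_sum fun k _ => ?_) hδ.le)
    rw [one_mul]
    refine hΦ _ _ (hFc k) (by fun_prop) (fun x => ⟨le_max_left _ _, ?_⟩) fun x hx => ?_
    · exact max_le zero_le_one (min_le_left _ _)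
    · have hx' : (k : ℝ) + 1 ≤ t x := hx
      rw [min_eq_left (by linarith), max_eq_right zero_le_one]

lemma integral_mono {f g : M → ℝ} {B C : ℝ} (hf : ∀ x, B ≤ f x) (hg : ∀ x, g x ≤ C)
    (h : ∀ x, f x ≤ g x) : ν.integral f ≤ ν.integral g := by
  rw [integral_eq_sSup f]
  refine csSup_le ⟨B, _, IsStep.const B, hf⟩ ?_
  rintro r ⟨s, hs, h'⟩
  exact hs.le_integral hg fun x => (h' x).trans (h x)

lemma integral_const (c : ℝ) : ν.integral (fun _ => c) = c :=
  le_antisymm ((IsStep.const c).integral_le (fun _ => le_rfl) fun _ => le_rfl)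
    ((IsStep.const c).le_integral (fun _ => le_rfl) fun _ => le_rfl)

lemma integral_add {f g : M → ℝ} (hf : Continuous f) (hg : Continuous g) {B C : ℝ}
    (hB : ∀ x, |f x| ≤ B) (hC : ∀ x, |g x| ≤ C) :
    ν.integral (fun x => f x + g x) = ν.integral f + ν.integral g := by
  have hb := fun x => abs_le.1 (hB x)
  have hc := fun x => abs_le.1 (hC x)
  refine eq_of_forall_dist_le fun ε hε => ?_
  obtain ⟨s, r, hs, hs1, hs2, -⟩ := exists_isStep_approx (ν := ν) hf hB (half_pos hε)
  obtain ⟨s', r', hs', hs1', hs2', -⟩ := exists_isStep_approx (ν := ν) hg hC (half_pos hε)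
  have h1 := hs.le_integral (fun x => (hb x).2) hs1
  have h2 := (hs.add (IsStep.const _)).integral_le (fun x => (hb x).1) hs2
  have h3 := hs'.le_integral (fun x => (hc x).2) hs1'
  have h4 := (hs'.add (IsStep.const _)).integral_le (fun x => (hc x).1) hs2'
  have h5 := (hs.add hs').le_integral (f := fun x => f x + g x) (B := B + C)
    (fun x => add_le_add (hb x).2 (hc x).2) (fun x => add_le_add (hs1 x) (hs1' x))
  have h6 := ((hs.add hs').add (IsStep.const ε)).integral_le (f := fun x => f x + g x)
    (B := -B + -C) (fun x => add_le_add (hb x).1 (hc x).1)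
    (fun x => by linarith [hs2 x, hs2' x])
  rw [Real.dist_eq, abs_le]
  constructor <;> linarith

lemma integral_const_mul {f : M → ℝ} (hf : Continuous f) {B : ℝ} (hB : ∀ x, |f x| ≤ B)
    (a : ℝ) : ν.integral (fun x => a * f x) = a * ν.integral f := by
  have hb := fun x => abs_le.1 (hB x)
  refine eq_of_forall_dist_le fun ε hε => ?_
  have hpos : 0 < |a| + 1 := by positivity
  obtain ⟨s, r, hs, hs1, hs2, -⟩ := exists_isStep_approx (ν := ν) hf hB (div_pos hε hpos)
  have h1 := hs.le_integral (fun x => (hb x).2) hs1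
  have h2 := (hs.add (IsStep.const _)).integral_le (fun x => (hb x).1) hs2
  have hbd : ∀ x, |a * f x| ≤ |a| * B := fun x => by
    rw [abs_mul]; exact mul_le_mul_of_nonneg_left (hB x) (abs_nonneg _)
  have hbd' := fun x => abs_le.1 (hbd x)
  have hε' : |a| * (ε / (|a| + 1)) ≤ ε := by
    rw [mul_div_assoc', div_le_iff₀ hpos]; nlinarith [abs_nonneg a]
  set η := ε / (|a| + 1)
  rw [Real.dist_eq, abs_le]
  rcases le_total 0 a with ha | ha
  · rw [abs_of_nonneg ha] at hε'
    have h3 := (hs.const_mul a).le_integral (f := fun x => a * f x) (fun x => (hbd' x).2)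
      (fun x => mul_le_mul_of_nonneg_left (hs1 x) ha)
    have h4 := ((hs.add (IsStep.const η)).const_mul a).integral_le (f := fun x => a * f x)
      (fun x => (hbd' x).1) (fun x => mul_le_mul_of_nonneg_left (hs2 x) ha)
    constructor <;> nlinarith
  · rw [abs_of_nonpos ha] at hε'
    have h3 := (hs.const_mul a).integral_le (f := fun x => a * f x) (fun x => (hbd' x).1)
      (fun x => mul_le_mul_of_nonpos_left (hs1 x) ha)
    have h4 := ((hs.add (IsStep.const η)).const_mul a).le_integral (f := fun x => a * f x)
      (fun x => (hbd' x).2) (fun x => mul_le_mul_of_nonpos_left (hs2 x) ha)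
    constructor <;> nlinarith

end RegularBorelCharge

end Integral

/-! ### Means -/

/-- A mean on a set `X`: a positive normalized linear functional on the bounded functions
`X → ℝ`, that is, integration against a finitely additive probability defined on all subsets.
It is encoded as a linear functional on all functions, whose values on unbounded functions carry
no meaning. -/
structure Mean (X : Type*) where
  /-- the underlying linear functional -/
  toLin : (X → ℝ) →ₗ[ℝ] ℝ
  map_one : toLin (fun _ => 1) = 1
  nonneg : ∀ (f : X → ℝ) (B : ℝ), (∀ x, f x ∈ Icc 0 B) → 0 ≤ toLin f

namespace Mean

variable {X : Type*}

instance : CoeFun (Mean X) fun _ => (X → ℝ) → ℝ := ⟨fun Λ => Λ.toLin⟩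

variable (Λ : Mean X)

lemma map_add (f g : X → ℝ) : Λ (fun x => f x + g x) = Λ f + Λ g := Λ.toLin.map_add f g

lemma map_sub (f g : X → ℝ) : Λ (fun x => f x - g x) = Λ f - Λ g := Λ.toLin.map_sub f g

lemma map_const_mul (a : ℝ) (f : X → ℝ) : Λ (fun x => a * f x) = a * Λ f := Λ.toLin.map_smul a f

lemma map_const (a : ℝ) : Λ (fun _ => a) = a := by
  simpa [Λ.map_one] using Λ.map_const_mul a (fun _ => 1)

lemma map_sum {ι : Type*} (s : Finset ι) (f : ι → X → ℝ) :
    Λ (fun x => ∑ i ∈ s, f i x) = ∑ i ∈ s, Λ (f i) := by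
  rw [← _root_.map_sum]
  congr 1
  funext x
  simp

lemma mono {f g : X → ℝ} {B C : ℝ} (hf : ∀ x, B ≤ f x) (hg : ∀ x, g x ≤ C)
    (h : ∀ x, f x ≤ g x) : Λ f ≤ Λ g := by
  have := Λ.nonneg (fun x => g x - f x) (C - B) fun x =>
    ⟨by linarith [h x], by linarith [hf x, hg x]⟩
  rw [Λ.map_sub] at this
  linarith

lemma le_of_forall_le {f : X → ℝ} {B C : ℝ} (hf : ∀ x, B ≤ f x) (h : ∀ x, f x ≤ C) : Λ f ≤ C :=
  (Λ.mono hf (fun _ => le_rfl) h).trans_eq (Λ.map_const C)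

lemma le_of_forall_ge {f : X → ℝ} {B C : ℝ} (hf : ∀ x, f x ≤ C) (h : ∀ x, B ≤ f x) : B ≤ Λ f :=
  (Λ.map_const B).symm.trans_le (Λ.mono (fun _ => le_rfl) hf h)

lemma abs_le {f : X → ℝ} {B : ℝ} (hf : ∀ x, |f x| ≤ B) : |Λ f| ≤ B := by
  have h := fun x => _root_.abs_le.1 (hf x)
  exact _root_.abs_le.2 ⟨Λ.le_of_forall_ge (fun x => (h x).2) fun x => (h x).1,
    Λ.le_of_forall_le (fun x => (h x).1) fun x => (h x).2⟩

end Mean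

/-- The bounded functions, as a subspace. -/
def boundedFunctions (X : Type*) : Submodule ℝ (X → ℝ) where
  carrier := {f | ∃ B, ∀ x, |f x| ≤ B}
  zero_mem' := ⟨0, by simp⟩
  add_mem' := by
    rintro f g ⟨B, hB⟩ ⟨C, hC⟩
    exact ⟨B + C, fun x => (abs_add_le _ _).trans (add_le_add (hB x) (hC x))⟩
  smul_mem' := by
    rintro a f ⟨B, hB⟩
    refine ⟨|a| * B, fun x => ?_⟩
    rw [Pi.smul_apply, smul_eq_mul, abs_mul]
    exact mul_le_mul_of_nonneg_left (hB x) (abs_nonneg a)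

/-- A convex cone of bounded functions with nonnegative suprema is nonnegative under some mean.
This is the Riesz extension theorem for the cone of all bounded functions which dominate
some element of `C`; the functional to extend is the evaluation of constants. -/
theorem exists_mean_nonneg {X : Type*} (C : PointedCone ℝ (X → ℝ))
    (hC : C ≤ PointedCone.ofSubmodule (boundedFunctions X))
    (hsup : ∀ c ∈ C, ∀ a : ℝ, (∀ x, c x ≤ a) → 0 ≤ a) :
    ∃ Λ : Mean X, ∀ c ∈ C, 0 ≤ Λ c := by
  let s : PointedCone ℝ (boundedFunctions X) :=
    { carrier := {f | ∃ c ∈ C, ∀ x, c x ≤ (f : X → ℝ) x}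
      zero_mem' := ⟨0, C.zero_mem, fun x => le_rfl⟩
      add_mem' := by
        rintro f g ⟨c, hc, hcf⟩ ⟨d, hd, hdg⟩
        exact ⟨c + d, C.add_mem hc hd, fun x => add_le_add (hcf x) (hdg x)⟩
      smul_mem' := by
        rintro a f ⟨c, hc, hcf⟩
        exact ⟨a • c, C.smul_mem a.2 hc, fun x => mul_le_mul_of_nonneg_left (hcf x) a.2⟩ }
  let one : boundedFunctions X := ⟨fun _ => 1, 1, by simp⟩
  have hone : one ≠ 0 := by
    intro h
    have h1 : ∀ x : X, (1 : ℝ) = 0 := fun x => congrFun (congrArg Subtype.val h) x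
    have h2 := hsup 0 C.zero_mem (-1) fun x => absurd (h1 x) one_ne_zero
    norm_num at h2
  let f : boundedFunctions X →ₗ.[ℝ] ℝ := LinearPMap.mkSpanSingleton one (1 : ℝ) hone
  have hf : ∀ (a : ℝ) (h : a • one ∈ f.domain), f ⟨a • one, h⟩ = a := fun a h => by
    have := LinearPMap.mkSpanSingleton'_apply one (1 : ℝ) (fun c hc => by
      rw [(smul_eq_zero.1 hc).resolve_right hone]; simp) a h
    exact this.trans (mul_one a)
  have hmem : ∀ a : ℝ, a • one ∈ f.domain := fun a =>
    Submodule.smul_mem _ _ (Submodule.mem_span_singleton_self one)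
  obtain ⟨g, hg, hgs⟩ := riesz_extension s f (by
    rintro ⟨x, hx⟩ ⟨c, hc, hcx⟩
    obtain ⟨a, rfl⟩ := Submodule.mem_span_singleton.1 hx
    rw [hf]
    refine hsup c hc a fun x => (hcx x).trans_eq ?_
    change a * 1 = a
    rw [mul_one]) (by
    rintro ⟨y, B, hB⟩
    refine ⟨⟨B • one, hmem B⟩, 0, C.zero_mem, fun x => ?_⟩
    change 0 ≤ B * 1 + y x
    linarith [(abs_le.1 (hB x)).1])
  obtain ⟨G, hG⟩ := g.exists_extend
  have hG' : ∀ f (hf : f ∈ boundedFunctions X), G f = g ⟨f, hf⟩ := fun f hf => by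
    rw [← hG]; rfl
  refine ⟨⟨G, ?_, ?_⟩, ?_⟩
  · rw [hG' _ one.2]
    have := hg ⟨(1 : ℝ) • one, hmem 1⟩
    rw [hf] at this
    simpa only [one_smul] using this
  · intro f B hfB
    rw [hG' f ⟨B, fun x => by rw [abs_of_nonneg (hfB x).1]; exact (hfB x).2⟩]
    exact hgs _ ⟨0, C.zero_mem, fun x => (hfB x).1⟩
  · intro c hc
    change 0 ≤ G c
    rw [hG' c (hC hc)]
    exact hgs _ ⟨c, hc, fun x => le_rfl⟩

/-! ### Representation of means on continuous functions by regular charges -/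

section Representation

variable {M : Type*} [PseudoMetricSpace M]

/-- `u` is a continuous function with values in `[0, 1]` which is `1` on `F`. -/
structure IsCutoff (F : Set M) (u : M → ℝ) : Prop where
  continuous : Continuous u
  mem_Icc : ∀ x, u x ∈ Icc (0 : ℝ) 1
  eq_one : ∀ x ∈ F, u x = 1

lemma isCutoff_one (F : Set M) : IsCutoff F fun _ => 1 :=
  ⟨continuous_const, fun _ => ⟨zero_le_one, le_rfl⟩, fun _ _ => rfl⟩

namespace Mean

variable (J : Mean M)

/-- The charge of a closed set: the infimum of the values of the mean on the continuous functions
above the indicator of the set. -/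
def closedVal (F : Set M) : ℝ := sInf {r | ∃ u, IsCutoff F u ∧ J u = r}

/-- The inner charge of an arbitrary set, approximated by closed subsets. -/
def innerVal (A : Set M) : ℝ := sSup {r | ∃ F ⊆ A, IsClosed F ∧ J.closedVal F = r}

variable {J}

lemma closedVal_le {F : Set M} {u : M → ℝ} (hu : IsCutoff F u) : J.closedVal F ≤ J u :=
  csInf_le ⟨0, by rintro r ⟨u, hu, rfl⟩; exact J.nonneg u 1 hu.mem_Icc⟩ ⟨u, hu, rfl⟩

lemma le_closedVal {F : Set M} {a : ℝ} (h : ∀ u, IsCutoff F u → a ≤ J u) : a ≤ J.closedVal F :=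
  le_csInf ⟨_, _, isCutoff_one F, rfl⟩ (by rintro r ⟨u, hu, rfl⟩; exact h u hu)

lemma exists_cutoff_lt (J : Mean M) (F : Set M) {ε : ℝ} (hε : 0 < ε) :
    ∃ u, IsCutoff F u ∧ J u < J.closedVal F + ε := by
  obtain ⟨r, ⟨u, hu, rfl⟩, h⟩ := exists_lt_of_csInf_lt
    (⟨_, _, isCutoff_one F, rfl⟩ : {r | ∃ u, IsCutoff F u ∧ J u = r}.Nonempty)
    (lt_add_of_pos_right (J.closedVal F) hε)
  exact ⟨u, hu, h⟩

lemma closedVal_nonneg (F : Set M) : 0 ≤ J.closedVal F :=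
  le_closedVal fun u hu => J.nonneg u 1 hu.mem_Icc

lemma closedVal_le_one (F : Set M) : J.closedVal F ≤ 1 :=
  (closedVal_le (isCutoff_one F)).trans_eq J.map_one

lemma closedVal_mono {F G : Set M} (h : F ⊆ G) : J.closedVal F ≤ J.closedVal G :=
  le_closedVal fun _ hu => closedVal_le ⟨hu.1, hu.2, fun x hx => hu.3 x (h hx)⟩

lemma closedVal_empty : J.closedVal ∅ = 0 := by
  refine le_antisymm ((closedVal_le (u := fun _ => 0) ⟨continuous_const, by simp, by simp⟩).trans_eq
    (J.map_const 0)) (closedVal_nonneg _)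

lemma closedVal_univ : J.closedVal univ = 1 := by
  refine le_antisymm (closedVal_le_one _) (le_closedVal fun u hu => ?_)
  have : u = fun _ => 1 := funext fun x => hu.eq_one x (mem_univ x)
  rw [this, J.map_one]

lemma closedVal_add_le {F G : Set M} (hF : IsClosed F) (hG : IsClosed G) (hd : Disjoint F G) :
    J.closedVal F + J.closedVal G ≤ J.closedVal (F ∪ G) := by
  refine le_closedVal fun u hu => ?_
  obtain ⟨p, hp0, hp1, hp⟩ := exists_continuous_zero_one_of_isClosed hF hG hd
  have h1 : IsCutoff F fun x => (1 - p x) * u x := by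
    refine ⟨by have := hu.1; fun_prop, fun x => ⟨?_, ?_⟩, fun x hx => ?_⟩
    · exact mul_nonneg (by linarith [(hp x).2]) (hu.2 x).1
    · exact mul_le_one₀ (by linarith [(hp x).1]) (hu.2 x).1 (hu.2 x).2
    · rw [hp0 hx, hu.3 x (Or.inl hx)]; simp
  have h2 : IsCutoff G fun x => p x * u x := by
    refine ⟨by have := hu.1; fun_prop, fun x => ⟨?_, ?_⟩, fun x hx => ?_⟩
    · exact mul_nonneg (hp x).1 (hu.2 x).1
    · exact mul_le_one₀ (hp x).2 (hu.2 x).1 (hu.2 x).2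
    · rw [hp1 hx, hu.3 x (Or.inr hx)]; simp
  calc _ ≤ _ := add_le_add (closedVal_le h1) (closedVal_le h2)
    _ = J u := by
      rw [← J.map_add]
      congr 1
      funext x
      ring

lemma innerVal_bddAbove (A : Set M) : BddAbove {r | ∃ F ⊆ A, IsClosed F ∧ J.closedVal F = r} :=
  ⟨1, by rintro r ⟨F, -, -, rfl⟩; exact closedVal_le_one F⟩

lemma closedVal_le_innerVal {F A : Set M} (hF : IsClosed F) (h : F ⊆ A) :
    J.closedVal F ≤ J.innerVal A :=
  le_csSup (innerVal_bddAbove A) ⟨F, h, hF, rfl⟩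

lemma innerVal_nonempty (A : Set M) :
    {r | ∃ F ⊆ A, IsClosed F ∧ J.closedVal F = r}.Nonempty :=
  ⟨_, ∅, empty_subset A, isClosed_empty, rfl⟩

lemma innerVal_le {A : Set M} {a : ℝ} (h : ∀ F ⊆ A, IsClosed F → J.closedVal F ≤ a) :
    J.innerVal A ≤ a :=
  csSup_le (innerVal_nonempty A) (by rintro r ⟨F, hFA, hF, rfl⟩; exact h F hFA hF)

lemma exists_lt_closedVal (J : Mean M) (A : Set M) {ε : ℝ} (hε : 0 < ε) :
    ∃ F ⊆ A, IsClosed F ∧ J.innerVal A - ε < J.closedVal F := by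
  obtain ⟨r, ⟨F, hFA, hF, rfl⟩, h⟩ := exists_lt_of_lt_csSup (innerVal_nonempty (J := J) A)
    (sub_lt_self (J.innerVal A) hε)
  exact ⟨F, hFA, hF, h⟩

lemma innerVal_of_isClosed {F : Set M} (hF : IsClosed F) : J.innerVal F = J.closedVal F :=
  le_antisymm (innerVal_le fun _ h _ => closedVal_mono h) (closedVal_le_innerVal hF subset_rfl)

lemma innerVal_nonneg (A : Set M) : 0 ≤ J.innerVal A :=
  (closedVal_nonneg ∅).trans (closedVal_le_innerVal isClosed_empty (empty_subset A))

lemma innerVal_empty : J.innerVal ∅ = 0 := by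
  rw [innerVal_of_isClosed isClosed_empty, closedVal_empty]

lemma innerVal_univ : J.innerVal univ = 1 := by
  rw [innerVal_of_isClosed isClosed_univ, closedVal_univ]

lemma innerVal_add_le {A B : Set M} (hd : Disjoint A B) :
    J.innerVal A + J.innerVal B ≤ J.innerVal (A ∪ B) := by
  refine le_of_forall_pos_le_add fun ε hε => ?_
  obtain ⟨F, hFA, hF, h1⟩ := J.exists_lt_closedVal A (half_pos hε)
  obtain ⟨G, hGB, hG, h2⟩ := J.exists_lt_closedVal B (half_pos hε)
  have h3 := closedVal_add_le (J := J) hF hG (hd.mono hFA hGB)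
  have h4 := closedVal_le_innerVal (J := J) (hF.union hG) (union_subset_union hFA hGB)
  linarith

/-- `A` splits every set additively with respect to the inner charge (Carathéodory's
condition). -/
def Splits (J : Mean M) (A : Set M) : Prop :=
  ∀ B, J.innerVal B = J.innerVal (B ∩ A) + J.innerVal (B \ A)

lemma Splits.compl {A : Set M} (hA : J.Splits A) : J.Splits Aᶜ := fun B => by
  rw [hA B, sdiff_compl, sdiff_eq_compl_inter, inter_comm Aᶜ, add_comm]

lemma Splits.union {A B : Set M} (hA : J.Splits A) (hB : J.Splits B) : J.Splits (A ∪ B) := by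
  intro E
  rw [hA E, hB (E \ A), hA (E ∩ (A ∪ B)), sdiff_sdiff]
  have h1 : E ∩ (A ∪ B) ∩ A = E ∩ A := by ext; simp; tauto
  have h2 : (E ∩ (A ∪ B)) \ A = (E \ A) ∩ B := by ext; simp; tauto
  rw [h1, h2, add_assoc]

/-- A closed set satisfies Carathéodory's condition: given a cutoff `u` of `G ∩ F` with `J u`
nearly optimal, the part of `G` where `u ≤ 1 - ε` is closed and disjoint from `F`. -/
lemma Splits.of_isClosed {F : Set M} (hF : IsClosed F) : J.Splits F := by
  intro B
  refine le_antisymm (innerVal_le fun G hGB hG => ?_) ?_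
  · refine le_of_forall_pos_le_add fun ε hε => ?_
    obtain ⟨u, hu, huJ⟩ := J.exists_cutoff_lt (G ∩ F) (half_pos hε)
    set H := G ∩ {x | u x ≤ 1 - ε / 2} with hHdef
    have hH : IsClosed H := hG.inter (isClosed_le hu.1 continuous_const)
    have hHB : H ⊆ B \ F := by
      rintro x ⟨hxG, hxu⟩
      refine ⟨hGB hxG, fun hxF => ?_⟩
      have : u x ≤ 1 - ε / 2 := hxu
      rw [hu.3 x ⟨hxG, hxF⟩] at this
      linarith
    have key : J.closedVal G - J u - ε / 2 ≤ J.closedVal H := by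
      refine le_closedVal fun p hp => ?_
      have hcut : IsCutoff G fun x => min 1 (u x + p x + ε / 2) := by
        refine ⟨by have := hu.1; have := hp.1; fun_prop, fun x => ⟨?_, min_le_left _ _⟩,
          fun x hx => ?_⟩
        · exact le_min zero_le_one (by linarith [(hu.2 x).1, (hp.2 x).1])
        · refine min_eq_left ?_
          by_cases hxH : x ∈ H
          · rw [hp.3 x hxH]; linarith [(hu.2 x).1]
          · have : ¬ u x ≤ 1 - ε / 2 := fun h => hxH ⟨hx, h⟩
            linarith [(hp.2 x).1]
      have h1 := closedVal_le (J := J) hcut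
      have h2 : J (fun x => min 1 (u x + p x + ε / 2)) ≤ J (fun x => u x + p x + ε / 2) :=
        J.mono (B := 0) (C := 1 + 1 + ε / 2) (fun x => (hcut.2 x).1)
          (fun x => by linarith [(hu.2 x).2, (hp.2 x).2]) fun x => min_le_right _ _
      rw [J.map_add, J.map_add, J.map_const] at h2
      linarith
    have h1 := closedVal_le_innerVal (J := J) (hG.inter hF) (inter_subset_inter_left F hGB)
    have h2 := closedVal_le_innerVal (J := J) hH hHB
    linarith
  · have := innerVal_add_le (J := J) (A := B ∩ F) (B := B \ F) disjoint_sdiff_inter.symm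
    rwa [inter_union_sdiff] at this

lemma Splits.of_mem_borelAlgebra {A : Set M} (hA : A ∈ borelAlgebra M) : J.Splits A := by
  have hs : IsSetAlgebra {A : Set M | J.Splits A} :=
    ⟨Splits.of_isClosed isClosed_empty, fun _ h => h.compl, fun _ _ h h' => h.union h'⟩
  refine IsSetAlgebra.generateSetAlgebra_subset ?_ hs hA
  intro U hU
  have := (Splits.of_isClosed (J := J) (IsOpen.isClosed_compl hU)).compl
  rwa [compl_compl] at this

lemma innerVal_compl {A : Set M} (hA : A ∈ borelAlgebra M) :
    J.innerVal Aᶜ = 1 - J.innerVal A := by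
  have := Splits.of_mem_borelAlgebra (J := J) hA univ
  rw [innerVal_univ, univ_inter, ← compl_eq_univ_sdiff] at this
  linarith

/-- The regular charge induced by a mean on a metric space. -/
def charge (J : Mean M) : RegularBorelCharge M where
  μ := isSetAlgebra_borelAlgebra.isSetRing.addContent_of_union J.innerVal innerVal_empty (by
    intro s t hs _ hd
    rw [Splits.of_mem_borelAlgebra hs (s ∪ t), union_inter_cancel_left, union_sdiff_left,
      hd.sdiff_eq_right])
  nonneg A _ := innerVal_nonneg A
  univ_eq_one := innerVal_univ
  inner_regular A _ := by
    have : {r : ℝ | ∃ F ⊆ A, IsClosed F ∧ J.innerVal F = r} =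
        {r | ∃ F ⊆ A, IsClosed F ∧ J.closedVal F = r} := by
      ext r
      refine exists_congr fun F => and_congr_right fun _ => and_congr_right fun hF => ?_
      rw [innerVal_of_isClosed hF]
    change IsLUB {r : ℝ | ∃ F ⊆ A, IsClosed F ∧ J.innerVal F = r} (J.innerVal A)
    rw [this]
    exact isLUB_csSup (innerVal_nonempty A) (innerVal_bddAbove A)
  outer_regular A hA := by
    change IsGLB {r : ℝ | ∃ G ⊇ A, IsOpen G ∧ J.innerVal G = r} (J.innerVal A)
    have hAc : J.innerVal A = 1 - J.innerVal Aᶜ := by rw [innerVal_compl hA]; ring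
    have hopen : ∀ G, IsOpen G → J.innerVal G = 1 - J.closedVal Gᶜ := fun G hG => by
      rw [← innerVal_of_isClosed hG.isClosed_compl, innerVal_compl (mem_borelAlgebra_of_isOpen hG)]
      ring
    constructor
    · rintro r ⟨G, hAG, hG, rfl⟩
      rw [hAc, hopen G hG]
      linarith [closedVal_le_innerVal (J := J) hG.isClosed_compl (compl_subset_compl.2 hAG)]
    · intro b hb
      have : J.innerVal Aᶜ ≤ 1 - b := innerVal_le fun F hFA hF => by
        have := hb ⟨Fᶜ, subset_compl_comm.1 hFA, hF.isOpen_compl, rfl⟩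
        rw [hopen _ hF.isOpen_compl, compl_compl] at this
        linarith
      linarith

/-- The regular charge of a mean integrates bounded continuous functions like the mean. -/
theorem integral_charge (J : Mean M) {f : M → ℝ} (hf : Continuous f) {B : ℝ}
    (hB : ∀ x, |f x| ≤ B) : J.charge.integral f = J f := by
  have key : ∀ {g : M → ℝ}, Continuous g → (∀ x, |g x| ≤ B) → J.charge.integral g ≤ J g := by
    intro g hg hgB
    refine le_of_forall_pos_le_add fun ε hε => ?_
    obtain ⟨s, r, hs, -, hle, hr⟩ :=
      RegularBorelCharge.exists_isStep_approx (ν := J.charge) hg hgB hε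
    have h1 := (hs.add (.const ε)).integral_le (fun x => (_root_.abs_le.1 (hgB x)).1) hle
    have h2 := hr J.toLin J.map_one fun F u hF hu hu1 hu2 =>
      (innerVal_of_isClosed hF).trans_le (closedVal_le ⟨hu, hu1, hu2⟩)
    linarith
  refine le_antisymm (key hf hB) ?_
  have h := key (g := fun x => -1 * f x) (by fun_prop) (by simpa using hB)
  rw [J.map_const_mul, RegularBorelCharge.integral_const_mul hf hB] at h
  linarith

end Mean

end Representation

/-! ### Boundedness and Lipschitz continuity of formulas -/

section FormulaEstimates

variable {L : LipschitzLanguage.{u, v}}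

/-- A bound for the absolute values of a formula which is valid in all structures. -/
def Formula.bound : {n : ℕ} → Formula L n → ℝ
  | _, .one => 1
  | _, .rel _ _ => 1
  | _, .rho _ _ => 1
  | _, .add φ ψ => bound φ + bound ψ
  | _, .smul r φ => |r| * bound φ
  | _, .inf φ => bound φ
  | _, .sup φ => bound φ
  | _, .int φ => bound φ

namespace Prestructure

variable {M : Type w} [PseudoMetricSpace M] (S : Prestructure L M)

lemma abs_val_le_bound {n : ℕ} (φ : Formula L n) : ∀ a, |S.val φ a| ≤ φ.bound := by
  have := S.charge.nonempty
  induction φ with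
  | one => intro a; simp [val, Formula.bound]
  | rel R t =>
    intro a
    simp only [val, Formula.bound]
    rw [abs_of_nonneg (S.relMap_mem _ _).1]
    exact (S.relMap_mem _ _).2
  | rho t₁ t₂ =>
    intro a
    simp only [val, Formula.bound]
    rw [abs_of_nonneg dist_nonneg]
    exact S.dist_le_one _ _
  | add φ ψ ih ih' =>
    intro a
    exact (abs_add_le _ _).trans (add_le_add (ih a) (ih' a))
  | smul r φ ih =>
    intro a
    simp only [val, Formula.bound]
    rw [abs_mul]
    exact mul_le_mul_of_nonneg_left (ih a) (abs_nonneg r)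
  | inf φ ih =>
    intro a
    have h := fun b => abs_le.1 (ih (Fin.snoc (α := fun _ => M) a b))
    obtain ⟨b₀⟩ := S.charge.nonempty
    exact abs_le.2 ⟨le_ciInf fun b => (h b).1,
      ciInf_le_of_le ⟨_, by rintro _ ⟨b, rfl⟩; exact (h b).1⟩ b₀ (h b₀).2⟩
  | sup φ ih =>
    intro a
    have h := fun b => abs_le.1 (ih (Fin.snoc (α := fun _ => M) a b))
    obtain ⟨b₀⟩ := S.charge.nonempty
    exact abs_le.2 ⟨le_ciSup_of_le ⟨_, by rintro _ ⟨b, rfl⟩; exact (h b).2⟩ b₀ (h b₀).1,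
      ciSup_le fun b => (h b).2⟩
  | int φ ih =>
    intro a
    have h := fun b => abs_le.1 (ih (Fin.snoc (α := fun _ => M) a b))
    exact abs_le.2 ⟨(RegularBorelCharge.IsStep.const _).le_integral (fun b => (h b).2)
      fun b => (h b).1, (RegularBorelCharge.IsStep.const _).integral_le (fun b => (h b).1)
      fun b => (h b).2⟩

lemma exists_termVal_lipschitz {n : ℕ} (t : L.toLanguage.Term (Fin n)) :
    ∃ K : ℝ, 0 ≤ K ∧ ∀ a b, dist (S.termVal a t) (S.termVal b t) ≤ K * ∑ i, dist (a i) (b i) := by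
  induction t with
  | var i =>
    refine ⟨1, zero_le_one, fun a b => ?_⟩
    rw [one_mul]
    simp only [termVal]
    exact Finset.single_le_sum (f := fun i => dist (a i) (b i)) (fun _ _ => dist_nonneg)
      (Finset.mem_univ i)
  | func F t ih =>
    choose K hK0 hK using ih
    refine ⟨L.funLip F * ∑ i, K i, mul_nonneg (NNReal.coe_nonneg _)
      (Finset.sum_nonneg fun i _ => hK0 i), fun a b => ?_⟩
    simp only [termVal]
    refine (S.funMap_lipschitz F _ _).trans ?_
    rw [mul_assoc, Finset.sum_mul]
    gcongr with i _
    exact hK i a b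

lemma sum_dist_snoc {n : ℕ} (a a' : Fin n → M) (b b' : M) :
    ∑ i, dist (Fin.snoc (α := fun _ => M) a b i) (Fin.snoc (α := fun _ => M) a' b' i) =
      ∑ i, dist (a i) (a' i) + dist b b' := by
  simp [Fin.sum_univ_castSucc]

lemma continuous_val_snoc_of_lipschitz {n : ℕ} {φ : Formula L (n + 1)} {K : ℝ} (hK0 : 0 ≤ K)
    (hK : ∀ a b, |S.val φ a - S.val φ b| ≤ K * ∑ i, dist (a i) (b i)) (a : Fin n → M) :
    Continuous fun b => S.val φ (Fin.snoc (α := fun _ => M) a b) := by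
  refine (LipschitzWith.of_dist_le_mul (K := ⟨K, hK0⟩) fun c c' => ?_).continuous
  have h1 := hK (Fin.snoc (α := fun _ => M) a c) (Fin.snoc (α := fun _ => M) a c')
  rwa [sum_dist_snoc, Finset.sum_eq_zero (fun i _ => dist_self (a i)), zero_add,
    ← Real.dist_eq] at h1

lemma exists_val_lipschitz {n : ℕ} (φ : Formula L n) :
    ∃ K : ℝ, 0 ≤ K ∧ ∀ a b, |S.val φ a - S.val φ b| ≤ K * ∑ i, dist (a i) (b i) := by
  have hne := S.charge.nonempty
  -- it suffices to bound one of the two differences, by symmetry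
  have hsymm : ∀ {m : ℕ} (ψ : Formula L m) (K : ℝ),
      (∀ a b, S.val ψ a ≤ S.val ψ b + K * ∑ i, dist (a i) (b i)) →
      ∀ a b, |S.val ψ a - S.val ψ b| ≤ K * ∑ i, dist (a i) (b i) := by
    intro m ψ K h a b
    have h1 := h a b
    have h2 := h b a
    simp only [dist_comm (b _)] at h2
    exact abs_le.2 ⟨by linarith, by linarith⟩
  induction φ with
  | one => exact ⟨0, le_rfl, fun a b => by simp [val]⟩
  | rel R t =>
    choose K hK0 hK using fun i => S.exists_termVal_lipschitz (t i)
    refine ⟨L.relLip R * ∑ i, K i, mul_nonneg (NNReal.coe_nonneg _)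
      (Finset.sum_nonneg fun i _ => hK0 i), fun a b => ?_⟩
    simp only [val]
    refine (S.relMap_lipschitz R _ _).trans ?_
    rw [mul_assoc, Finset.sum_mul]
    gcongr with i _
    exact hK i a b
  | rho t₁ t₂ =>
    obtain ⟨K, hK0, hK⟩ := S.exists_termVal_lipschitz t₁
    obtain ⟨K', hK0', hK'⟩ := S.exists_termVal_lipschitz t₂
    refine ⟨K + K', add_nonneg hK0 hK0', fun a b => ?_⟩
    have := dist_dist_dist_le (S.termVal a t₁) (S.termVal a t₂) (S.termVal b t₁) (S.termVal b t₂)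
    rw [Real.dist_eq] at this
    rw [add_mul]
    exact this.trans (add_le_add (hK a b) (hK' a b))
  | add φ ψ ih ih' =>
    obtain ⟨K, hK0, hK⟩ := ih
    obtain ⟨K', hK0', hK'⟩ := ih'
    refine ⟨K + K', add_nonneg hK0 hK0', fun a b => ?_⟩
    simp only [val]
    rw [add_mul, add_sub_add_comm]
    exact (abs_add_le _ _).trans (add_le_add (hK a b) (hK' a b))
  | smul r φ ih =>
    obtain ⟨K, hK0, hK⟩ := ih
    refine ⟨|r| * K, mul_nonneg (abs_nonneg r) hK0, fun a b => ?_⟩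
    simp only [val]
    rw [← mul_sub, abs_mul, mul_assoc]
    exact mul_le_mul_of_nonneg_left (hK a b) (abs_nonneg r)
  | inf φ ih =>
    obtain ⟨K, hK0, hK⟩ := ih
    refine ⟨K, hK0, hsymm _ K fun a b => ?_⟩
    simp only [val]
    rw [← sub_le_iff_le_add]
    refine le_ciInf fun c => ?_
    have h1 := (abs_le.1 (hK (Fin.snoc (α := fun _ => M) a c) (Fin.snoc (α := fun _ => M) b c))).2
    rw [sum_dist_snoc, dist_self, add_zero] at h1
    have h2 : ⨅ c : M, S.val φ (Fin.snoc (α := fun _ => M) a c) ≤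
        S.val φ (Fin.snoc (α := fun _ => M) a c) :=
      ciInf_le ⟨-φ.bound, by rintro _ ⟨c, rfl⟩; exact (abs_le.1 (S.abs_val_le_bound φ _)).1⟩ c
    linarith
  | sup φ ih =>
    obtain ⟨K, hK0, hK⟩ := ih
    refine ⟨K, hK0, hsymm _ K fun a b => ?_⟩
    simp only [val]
    refine ciSup_le fun c => ?_
    have h1 := (abs_le.1 (hK (Fin.snoc (α := fun _ => M) a c) (Fin.snoc (α := fun _ => M) b c))).2
    rw [sum_dist_snoc, dist_self, add_zero] at h1
    have h2 : S.val φ (Fin.snoc (α := fun _ => M) b c) ≤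
        ⨆ c : M, S.val φ (Fin.snoc (α := fun _ => M) b c) :=
      le_ciSup (f := fun c => S.val φ (Fin.snoc (α := fun _ => M) b c)) ⟨φ.bound, by
        rintro _ ⟨c, rfl⟩; exact (abs_le.1 (S.abs_val_le_bound φ _)).2⟩ c
    linarith
  | int φ ih =>
    obtain ⟨K, hK0, hK⟩ := ih
    refine ⟨K, hK0, hsymm _ K fun a b => ?_⟩
    simp only [val]
    have hcont : Continuous fun c => S.val φ (Fin.snoc (α := fun _ => M) b c) :=
      S.continuous_val_snoc_of_lipschitz hK0 hK b
    rw [← S.charge.integral_const (K * ∑ i, dist (a i) (b i)),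
      ← RegularBorelCharge.integral_add hcont continuous_const
        (fun c => S.abs_val_le_bound φ _) (fun _ => le_rfl)]
    refine RegularBorelCharge.integral_mono (B := -φ.bound)
      (C := φ.bound + K * ∑ i, dist (a i) (b i))
      (fun c => (abs_le.1 (S.abs_val_le_bound φ _)).1)
      (fun c => add_le_add (abs_le.1 (S.abs_val_le_bound φ _)).2 le_rfl) fun c => ?_
    have h1 := (abs_le.1 (hK (Fin.snoc (α := fun _ => M) a c) (Fin.snoc (α := fun _ => M) b c))).2
    rw [sum_dist_snoc, dist_self, add_zero] at h1
    linarith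

lemma continuous_val_snoc {n : ℕ} (φ : Formula L (n + 1)) (a : Fin n → M) :
    Continuous fun b => S.val φ (Fin.snoc (α := fun _ => M) a b) := by
  obtain ⟨K, hK0, hK⟩ := S.exists_val_lipschitz φ
  exact S.continuous_val_snoc_of_lipschitz hK0 hK a

lemma val_linComb {n : ℕ} (k : ℕ) (r : Fin k → ℝ) (φ : Fin k → Formula L n) (a : Fin n → M) :
    S.val (Formula.linComb k r φ) a = ∑ i, r i * S.val (φ i) a := by
  induction k with
  | zero => simp [Formula.linComb, val]
  | succ k ih => simp [Formula.linComb, val, ih, Fin.sum_univ_castSucc]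

end Prestructure

end FormulaEstimates

/-! ### Lipschitz extension to a completion -/

section Completion

open UniformSpace

variable {X : Type*} [PseudoMetricSpace X]

lemma isUniformInducing_coe_tuple (X : Type*) [PseudoMetricSpace X] (n : ℕ) :
    IsUniformInducing (fun (a : Fin n → X) (j : Fin n) => (a j : Completion X)) :=
  (Isometry.piMap (fun (_ : Fin n) (x : X) => (x : Completion X))
    fun _ => Completion.coe_isometry).isUniformInducing

lemma denseRange_coe_tuple (X : Type*) [PseudoMetricSpace X] (n : ℕ) :
    DenseRange (fun (a : Fin n → X) (j : Fin n) => (a j : Completion X)) :=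
  DenseRange.piMap (f := fun (_ : Fin n) (x : X) => (x : Completion X))
    fun _ => Completion.denseRange_coe

lemma exists_lipschitz_extension {Y : Type*} [MetricSpace Y] [CompleteSpace Y] {n : ℕ}
    (f : (Fin n → X) → Y) (K : ℝ≥0) (hf : ∀ a b, dist (f a) (f b) ≤ K * ∑ i, dist (a i) (b i)) :
    ∃ g : (Fin n → Completion X) → Y, Continuous g ∧
      (∀ a, g (fun j => (a j : Completion X)) = f a) ∧
      ∀ a b, dist (g a) (g b) ≤ K * ∑ i, dist (a i) (b i) := by
  have hu := isUniformInducing_coe_tuple X n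
  have hd := denseRange_coe_tuple X n
  have hfu : UniformContinuous f := by
    refine (LipschitzWith.of_dist_le_mul (K := K * n) fun a b => (hf a b).trans ?_).uniformContinuous
    push_cast
    rw [mul_assoc]
    gcongr
    refine (Finset.sum_le_sum fun i _ => dist_le_pi_dist a b i).trans ?_
    simp
  have hg := (uniformContinuous_uniformly_extend hu hd hfu).continuous
  have hgf := uniformly_extend_of_ind hu hd hfu
  refine ⟨_, hg, hgf, fun a b => ?_⟩
  refine isClosed_property2 hd (p := fun a b => dist ((hu.isDenseInducing hd).extend f a)
    ((hu.isDenseInducing hd).extend f b) ≤ K * ∑ i, dist (a i) (b i)) ?_ ?_ a b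
  · exact isClosed_le (by fun_prop) (by fun_prop)
  · intro a b
    rw [hgf, hgf]
    simpa [Completion.dist_eq] using hf a b

lemma iInf_completion {f : Completion X → ℝ} (hf : Continuous f) {B : ℝ} (hB : ∀ x, |f x| ≤ B) :
    ⨅ x : Completion X, f x = ⨅ x : X, f x := by
  rw [← (Completion.denseRange_coe (α := X)).ciInf hf ⟨-B, by
    rintro _ ⟨x, rfl⟩; exact (abs_le.1 (hB x)).1⟩]
  exact iInf_range' _ _

lemma iSup_completion {f : Completion X → ℝ} (hf : Continuous f) {B : ℝ} (hB : ∀ x, |f x| ≤ B) :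
    ⨆ x : Completion X, f x = ⨆ x : X, f x := by
  rw [← (Completion.denseRange_coe (α := X)).ciSup hf ⟨B, by
    rintro _ ⟨x, rfl⟩; exact (abs_le.1 (hB x)).2⟩]
  exact iSup_range' _ _

end Completion

/-! ### Ultrameans -/

namespace Mean

/-- The image of a mean under a map. -/
def map {X Y : Type*} (J : Mean X) (g : X → Y) : Mean Y where
  toLin := J.toLin ∘ₗ LinearMap.funLeft ℝ ℝ g
  map_one := J.map_one
  nonneg f B hf := J.nonneg (fun x => f (g x)) B fun x => hf (g x)

lemma map_apply {X Y : Type*} (J : Mean X) (g : X → Y) (f : Y → ℝ) :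
    J.map g f = J (fun x => f (g x)) := rfl

end Mean

section Ultramean

variable {L : LipschitzLanguage.{u, v}} {I : Type*} {M : I → Type w} [∀ i, MetricSpace (M i)]

/-- The ultramean of a family of structures with respect to a mean `Λ` on the index set, before
passing to the completion: its points are the choices of a point in each structure, at distance
`Λ (fun i => dist (a i) (b i))`. -/
@[nolint unusedArguments]
def Ultramean (_ : Mean I) (_ : ∀ i, Prestructure L (M i)) : Type _ := ∀ i, M i

variable (Λ : Mean I) (S : ∀ i, Prestructure L (M i))

instance : PseudoMetricSpace (Ultramean Λ S) where
  dist a b := Λ fun i => dist (a i) (b i)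
  dist_self a := by simpa using Λ.map_const 0
  dist_comm a b := by simp only [dist_comm]
  dist_triangle a b c := by
    rw [← Λ.map_add]
    exact Λ.mono (B := 0) (C := 1 + 1) (fun i => dist_nonneg)
      (fun i => add_le_add ((S i).dist_le_one _ _) ((S i).dist_le_one _ _))
      fun i => dist_triangle _ _ _

namespace Ultramean

/-- The point of the ultramean given by a choice of points. -/
def mk (b : ∀ i, M i) : Ultramean Λ S := b

lemma dist_def (a b : Ultramean Λ S) : dist a b = Λ fun i => dist (a i) (b i) := rfl

/-- A mean on the ultramean which integrates `b ↦ Λ (f i (b i))` to the mean of the integrals of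
the `f i`.  It exists because `b` may be chosen with each `f i (b i)` nearly as large as the
integral of `f i`, so that a function of this form with integral `0` has nonnegative supremum. -/
theorem exists_mean_integral :
    ∃ J : Mean (Ultramean Λ S), ∀ (f : ∀ i, M i → ℝ) (B : ℝ), (∀ i, Continuous (f i)) →
      (∀ i x, |f i x| ≤ B) →
      J (fun b => Λ fun i => f i (b i)) = Λ fun i => (S i).charge.integral (f i) := by
  let C : PointedCone ℝ (Ultramean Λ S → ℝ) :=
    { carrier := {h | ∃ (f : ∀ i, M i → ℝ) (B : ℝ), (∀ i, Continuous (f i)) ∧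
        (∀ i x, |f i x| ≤ B) ∧ (Λ fun i => (S i).charge.integral (f i)) = 0 ∧
        h = fun b => Λ fun i => f i (b i)}
      zero_mem' := by
        refine ⟨fun _ _ => 0, 0, fun _ => continuous_const, fun _ _ => by simp, ?_, ?_⟩
        · simpa [RegularBorelCharge.integral_const] using Λ.map_const 0
        · funext b
          exact (Λ.map_const 0).symm
      add_mem' := by
        rintro _ _ ⟨f, B, hf, hfB, hf0, rfl⟩ ⟨g, B', hg, hgB, hg0, rfl⟩
        refine ⟨fun i x => f i x + g i x, B + B', fun i => (hf i).add (hg i),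
          fun i x => (abs_add_le _ _).trans (add_le_add (hfB i x) (hgB i x)), ?_, ?_⟩
        · simp only [RegularBorelCharge.integral_add (hf _) (hg _) (hfB _) (hgB _)]
          rw [Λ.map_add, hf0, hg0, add_zero]
        · funext b
          exact (Λ.map_add _ _).symm
      smul_mem' := by
        rintro ⟨a, ha⟩ _ ⟨f, B, hf, hfB, hf0, rfl⟩
        refine ⟨fun i x => a * f i x, |a| * B, fun i => continuous_const.mul (hf i),
          fun i x => ?_, ?_, ?_⟩
        · rw [abs_mul]
          exact mul_le_mul_of_nonneg_left (hfB i x) (abs_nonneg a)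
        · simp only [RegularBorelCharge.integral_const_mul (hf _) (hfB _)]
          rw [Λ.map_const_mul, hf0, mul_zero]
        · funext b
          exact (Λ.map_const_mul _ _).symm }
  obtain ⟨J, hJ⟩ := exists_mean_nonneg C (by
    rintro _ ⟨f, B, hf, hfB, hf0, rfl⟩
    exact ⟨B, fun b => Λ.abs_le fun i => hfB i (b i)⟩) (by
    rintro _ ⟨f, B, hf, hfB, hf0, rfl⟩ a ha
    refine le_of_forall_pos_le_add fun ε hε => ?_
    have hex : ∀ i, ∃ x, (S i).charge.integral (f i) - ε ≤ f i x := by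
      intro i
      by_contra! hlt
      have := (RegularBorelCharge.IsStep.const (ν := (S i).charge) _).integral_le
        (fun x => (abs_le.1 (hfB i x)).1) fun x => (hlt x).le
      linarith
    choose b hb using hex
    have h1 : (Λ fun i => (S i).charge.integral (f i) - ε) ≤ Λ fun i => f i (b i) := by
      refine Λ.mono (B := -B - ε) (C := B) (fun i => ?_) (fun i => (abs_le.1 (hfB i _)).2) hb
      have := (RegularBorelCharge.IsStep.const (ν := (S i).charge) _).le_integral
        (fun x => (abs_le.1 (hfB i x)).2) fun x => (abs_le.1 (hfB i x)).1
      linarith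
    rw [Λ.map_sub, Λ.map_const, hf0] at h1
    linarith [ha b])
  have key : ∀ (f : ∀ i, M i → ℝ) (B : ℝ), (∀ i, Continuous (f i)) → (∀ i x, |f i x| ≤ B) →
      (Λ fun i => (S i).charge.integral (f i)) ≤ J (fun b => Λ fun i => f i (b i)) := by
    intro f B hf hfB
    set l := Λ fun i => (S i).charge.integral (f i) with hl
    have h0 := hJ (fun b => Λ fun i => f i (b i) + -l) ⟨fun i x => f i x + -l, B + |(-l)|,
      fun i => (hf i).add continuous_const,
      fun i x => (abs_add_le _ _).trans (add_le_add (hfB i x) le_rfl), by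
        simp only [RegularBorelCharge.integral_add (hf _) continuous_const (hfB _)
          (fun _ => le_rfl), RegularBorelCharge.integral_const]
        rw [Λ.map_add, Λ.map_const, ← hl, add_neg_cancel], rfl⟩
    simp only [Λ.map_add, Λ.map_const, J.map_add, J.map_const] at h0
    linarith
  refine ⟨J, fun f B hf hfB => le_antisymm ?_ (key f B hf hfB)⟩
  have h := key (fun i x => -1 * f i x) B (fun i => continuous_const.mul (hf i))
    (fun i x => by simpa using hfB i x)
  simp only [RegularBorelCharge.integral_const_mul (hf _) (hfB _), Λ.map_const_mul,
    J.map_const_mul] at h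
  linarith

variable {S}

lemma iInf_mean {f : ∀ i, M i → ℝ} {B : ℝ} (hB : ∀ i x, |f i x| ≤ B) :
    ⨅ b : Ultramean Λ S, Λ (fun i => f i (b i)) = Λ fun i => ⨅ x, f i x := by
  have hne : ∀ i, Nonempty (M i) := fun i => (S i).charge.nonempty
  have : Nonempty (Ultramean Λ S) := ⟨fun i => Classical.choice (hne i)⟩
  have hb := fun i x => abs_le.1 (hB i x)
  have hbdd : ∀ i, BddBelow (range (f i)) := fun i => ⟨-B, by rintro _ ⟨x, rfl⟩; exact (hb i x).1⟩
  have hinf : ∀ i, -B ≤ ⨅ x, f i x := fun i => le_ciInf fun x => (hb i x).1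
  refine le_antisymm (le_of_forall_pos_le_add fun ε hε => ?_) (le_ciInf fun b => ?_)
  · choose b hbε using fun i => exists_lt_of_ciInf_lt (lt_add_of_pos_right (⨅ x, f i x) hε)
    have h1 : ⨅ b : Ultramean Λ S, Λ (fun i => f i (b i)) ≤ Λ (fun i => f i (b i)) :=
      ciInf_le (f := fun b : Ultramean Λ S => Λ (fun i => f i (b i)))
        ⟨-B, by rintro _ ⟨b, rfl⟩; exact (abs_le.1 (Λ.abs_le fun i => hB i (b i))).1⟩ b
    have h2 : Λ (fun i => f i (b i)) ≤ Λ fun i => (⨅ x, f i x) + ε :=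
      Λ.mono (fun i => (hb i _).1)
        (fun i => add_le_add ((ciInf_le (hbdd i) (b i)).trans (hb i (b i)).2) le_rfl)
        fun i => (hbε i).le
    rw [Λ.map_add, Λ.map_const] at h2
    exact h1.trans h2
  · exact Λ.mono hinf (fun i => (hb i _).2) fun i => ciInf_le (hbdd i) (b i)

lemma iSup_mean {f : ∀ i, M i → ℝ} {B : ℝ} (hB : ∀ i x, |f i x| ≤ B) :
    ⨆ b : Ultramean Λ S, Λ (fun i => f i (b i)) = Λ fun i => ⨆ x, f i x := by
  have h := iInf_mean Λ (S := S) (f := fun i x => -1 * f i x) (B := B)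
    fun i x => by simpa using hB i x
  have hneg : (-1 : ℝ) ≤ 0 := by norm_num
  simp only [Λ.map_const_mul, ← Real.mul_iSup_of_nonpos hneg] at h
  linarith

variable (S)

/-- **Ultramean theorem.** The completion of the ultramean carries a structure in which the value
of a formula is the mean of its values. -/
theorem exists_prestructure :
    ∃ T : Prestructure L (UniformSpace.Completion (Ultramean Λ S)),
      ∀ {n : ℕ} (φ : Formula L n) (a : Fin n → Ultramean Λ S),
        T.val φ (fun j => (a j : UniformSpace.Completion (Ultramean Λ S))) =
          Λ fun i => (S i).val φ fun j => a j i := by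
  have hfun : ∀ {n : ℕ} (F : L.Functions n),
      ∃ g : (Fin n → UniformSpace.Completion (Ultramean Λ S)) →
      UniformSpace.Completion (Ultramean Λ S),
      (∀ a : Fin n → Ultramean Λ S, g (fun j => (a j : UniformSpace.Completion (Ultramean Λ S))) =
        (mk Λ S (fun i => (S i).funMap F fun j => a j i) :
          UniformSpace.Completion (Ultramean Λ S))) ∧
      ∀ a b, dist (g a) (g b) ≤ L.funLip F * ∑ i, dist (a i) (b i) := by
    intro n F
    obtain ⟨g, -, h1, h2⟩ := exists_lipschitz_extension (X := Ultramean Λ S)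
      (fun a => (mk Λ S (fun i => (S i).funMap F fun j => a j i) :
        UniformSpace.Completion (Ultramean Λ S))) (L.funLip F) (fun a b => by
        rw [UniformSpace.Completion.dist_eq]
        simp only [dist_def]
        rw [← Λ.map_sum, ← Λ.map_const_mul]
        refine Λ.mono (B := 0) (C := L.funLip F * ∑ _j : Fin n, 1) (fun i => dist_nonneg)
          (fun i => ?_) fun i => (S i).funMap_lipschitz F _ _
        gcongr with j _
        exact (S i).dist_le_one _ _)
    exact ⟨g, h1, h2⟩
  have hrel : ∀ {n : ℕ} (R : L.Relations n),
      ∃ g : (Fin n → UniformSpace.Completion (Ultramean Λ S)) → ℝ,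
      (∀ a : Fin n → Ultramean Λ S, g (fun j => (a j : UniformSpace.Completion (Ultramean Λ S))) =
        Λ fun i => (S i).relMap R fun j => a j i) ∧ (∀ a, g a ∈ Icc (0 : ℝ) 1) ∧
      ∀ a b, |g a - g b| ≤ L.relLip R * ∑ i, dist (a i) (b i) := by
    intro n R
    obtain ⟨g, hc, h1, h2⟩ := exists_lipschitz_extension (X := Ultramean Λ S)
      (fun a => Λ fun i => (S i).relMap R fun j => a j i) (L.relLip R) (fun a b => by
        simp only [dist_def]
        rw [← Λ.map_sum, ← Λ.map_const_mul, Real.dist_eq, ← Λ.map_sub]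
        have hlip := fun i => abs_le.1 ((S i).relMap_lipschitz R (fun j => a j i) fun j => b j i)
        have hb : ∀ i, L.relLip R * ∑ j, dist (a j i) (b j i) ≤ L.relLip R * ∑ _j : Fin n, (1 : ℝ) :=
          fun i => by
            gcongr with j _
            exact (S i).dist_le_one _ _
        refine abs_le.2 ⟨?_, ?_⟩
        · rw [← neg_one_mul, ← Λ.map_const_mul]
          refine Λ.mono (B := -(L.relLip R * ∑ _j : Fin n, (1 : ℝ))) (C := 1) (fun i => ?_)
            (fun i => ?_) fun i => ?_
          · linarith [hb i]
          · linarith [((S i).relMap_mem R fun j => a j i).2, ((S i).relMap_mem R fun j => b j i).1]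
          · linarith [(hlip i).1]
        · refine Λ.mono (B := -1) (fun i => ?_) hb fun i => (hlip i).2
          linarith [((S i).relMap_mem R fun j => a j i).1, ((S i).relMap_mem R fun j => b j i).2])
    refine ⟨g, h1, fun a => ?_, h2⟩
    refine isClosed_property (denseRange_coe_tuple _ n) (p := fun a => g a ∈ Icc (0 : ℝ) 1)
      (isClosed_Icc.preimage hc) (fun a => ?_) a
    rw [h1]
    exact ⟨Λ.le_of_forall_ge (fun i => ((S i).relMap_mem R _).2) fun i => ((S i).relMap_mem R _).1,
      Λ.le_of_forall_le (fun i => ((S i).relMap_mem R _).1) fun i => ((S i).relMap_mem R _).2⟩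
  choose! funMap hfunMap hfunLip using @hfun
  choose! relMap hrelMap hrelMem hrelLip using @hrel
  obtain ⟨J, hJ⟩ := exists_mean_integral Λ S
  let N := UniformSpace.Completion (Ultramean Λ S)
  let J' : Mean N := J.map fun b => (b : N)
  let T : Prestructure L N :=
    { dist_le_one := fun x y => by
        refine isClosed_property2 (UniformSpace.Completion.denseRange_coe (α := Ultramean Λ S))
          (p := fun x y => dist x y ≤ 1) (isClosed_le (by fun_prop) continuous_const)
          (fun a b => ?_) x y
        rw [UniformSpace.Completion.dist_eq, dist_def]
        exact Λ.le_of_forall_le (fun i => dist_nonneg) fun i => (S i).dist_le_one _ _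
      funMap := funMap
      funMap_lipschitz := hfunLip
      relMap := relMap
      relMap_mem := hrelMem
      relMap_lipschitz := hrelLip
      charge := J'.charge }
  have hsnoc : ∀ {n : ℕ} (a : Fin n → Ultramean Λ S) (b : Ultramean Λ S),
      (Fin.snoc (α := fun _ => N) (fun j => (a j : N)) (b : N) : Fin (n + 1) → N) =
        fun j => ((Fin.snoc (α := fun _ => Ultramean Λ S) a b j : Ultramean Λ S) : N) := by
    intro n a b
    funext j
    refine Fin.lastCases ?_ (fun j => ?_) j <;> simp
  have hsnoc' : ∀ {n : ℕ} (a : Fin n → Ultramean Λ S) (b : Ultramean Λ S) (i : I),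
      (fun j => Fin.snoc (α := fun _ => Ultramean Λ S) a b j i) =
        Fin.snoc (α := fun _ => M i) (fun j => a j i) (b i) := by
    intro n a b i
    funext j
    refine Fin.lastCases ?_ (fun j => ?_) j <;> simp
  have hterm : ∀ {n : ℕ} (t : L.toLanguage.Term (Fin n)) (a : Fin n → Ultramean Λ S),
      T.termVal (fun j => (a j : N)) t =
        (mk Λ S (fun i => (S i).termVal (fun j => a j i) t) : N) := by
    intro n t a
    induction t with
    | var j => rfl
    | func F t ih =>
      simp only [Prestructure.termVal, ih]
      exact hfunMap F _
  refine ⟨T, fun {n} φ => ?_⟩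
  induction φ with
  | one => intro a; exact Λ.map_one.symm
  | rel R t =>
    intro a
    simp only [Prestructure.val, hterm]
    exact hrelMap R _
  | rho t₁ t₂ =>
    intro a
    simp only [Prestructure.val, hterm]
    exact UniformSpace.Completion.dist_eq _ _
  | add φ ψ ih ih' =>
    intro a
    simp only [Prestructure.val, ih, ih', Λ.map_add]
  | smul r φ ih =>
    intro a
    simp only [Prestructure.val, ih, Λ.map_const_mul]
  | inf φ ih =>
    intro a
    simp only [Prestructure.val]
    rw [iInf_completion (T.continuous_val_snoc φ _) fun x => T.abs_val_le_bound φ _,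
      ← iInf_mean Λ (S := S) fun i x => (S i).abs_val_le_bound φ _]
    simp only [hsnoc, ih, hsnoc']
  | sup φ ih =>
    intro a
    simp only [Prestructure.val]
    rw [iSup_completion (T.continuous_val_snoc φ _) fun x => T.abs_val_le_bound φ _,
      ← iSup_mean Λ (S := S) fun i x => (S i).abs_val_le_bound φ _]
    simp only [hsnoc, ih, hsnoc']
  | int φ ih =>
    intro a
    simp only [Prestructure.val]
    rw [← hJ _ φ.bound (fun i => (S i).continuous_val_snoc φ _)
      fun i x => (S i).abs_val_le_bound φ _]
    refine (J'.integral_charge (T.continuous_val_snoc φ _) fun x => T.abs_val_le_bound φ _).trans ?_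
    rw [Mean.map_apply]
    simp only [hsnoc, ih, hsnoc']

end Ultramean

end Ultramean

/-! ### Affine compactness -/

/-- The model is an ultramean over all satisfiable conditions, with one chosen structure for
each.  Affine satisfiability implies that the cone spanned by the differences
`rhs - lhs` of the conditions in `T`, as functions of the chosen structure, has no element with
negative supremum, so that some mean is nonnegative on it. -/
theorem Theory.AffinelySatisfiable.satisfiable {L : LipschitzLanguage.{u, v}} {T : Theory L}
    (hT : Theory.AffinelySatisfiable.{u, v, w} T) : Theory.Satisfiable.{u, v, max u v w} T := by
  let I := {C : Condition L // Condition.Satisfiable.{u, v, w} C}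
  choose M hM _ S hS using fun i : I => i.2
  let gap : Condition L → I → ℝ := fun C i => (S i).sentenceVal C.rhs - (S i).sentenceVal C.lhs
  have hgap : ∀ C, gap C ∈ boundedFunctions I := fun C =>
    ⟨C.rhs.bound + C.lhs.bound, fun i => (abs_sub _ _).trans
      (add_le_add ((S i).abs_val_le_bound _ _) ((S i).abs_val_le_bound _ _))⟩
  obtain ⟨Λ, hΛ⟩ := exists_mean_nonneg (Submodule.span _ (gap '' T) : PointedCone ℝ (I → ℝ))
    (Submodule.span_le.2 (by rintro _ ⟨C, -, rfl⟩; exact hgap C)) (by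
      intro c hc a ha
      obtain ⟨k, r, g, rfl⟩ := Submodule.mem_span_set'.1 hc
      choose C hCT hCg using fun i => (g i).2
      -- test at the index given by the combination itself, whose structure satisfies it
      let i₀ : I := ⟨Condition.linComb k (fun i => (r i : ℝ)) C, hT k _ C (fun i => (r i).2) hCT⟩
      have h1 : (S i₀).val (Formula.linComb k (fun i => (r i : ℝ)) fun i => (C i).lhs) Fin.elim0 ≤
          (S i₀).val (Formula.linComb k (fun i => (r i : ℝ)) fun i => (C i).rhs) Fin.elim0 := hS i₀
      have h2 := ha i₀
      rw [Prestructure.val_linComb, Prestructure.val_linComb] at h1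
      rw [Finset.sum_apply] at h2
      have h3 : ∀ i, (r i • (g i : I → ℝ)) i₀ = (r i : ℝ) * (S i₀).val (C i).rhs Fin.elim0 -
          (r i : ℝ) * (S i₀).val (C i).lhs Fin.elim0 := fun i => by
        rw [← hCg i, ← mul_sub]
        rfl
      rw [Finset.sum_congr rfl fun i _ => h3 i, Finset.sum_sub_distrib] at h2
      linarith)
  obtain ⟨N, hN⟩ := Ultramean.exists_prestructure Λ S
  refine ⟨_, inferInstance, inferInstance, N, fun C hC => ?_⟩
  have h := hΛ _ (Submodule.subset_span ⟨C, hC, rfl⟩)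
  have hval : ∀ σ : Sentence L, N.sentenceVal σ = Λ fun i => (S i).sentenceVal σ := fun σ => by
    have h0 := hN σ Fin.elim0
    have hval0 : ∀ i, (S i).sentenceVal σ =
        (S i).val σ fun j => (Fin.elim0 j : Ultramean Λ S) i := fun i =>
      congrArg ((S i).val σ) (Subsingleton.elim _ _)
    simp only [hval0]
    exact (congrArg (N.val σ) (Subsingleton.elim _ _)).trans h0
  simp only [gap, Λ.map_sub] at h
  rw [Prestructure.Satisfies, hval, hval]
  linarith

end AffineIntegration

end

/-- Affine compactness: every affinely satisfiable theory of affine integration logic is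
satisfiable.  If the symbols of the language lie in the universes `u`, `v` and the given
structures in the universe `w`, then the model lies in `max u v w`; the choice
`w = max u v w'` gives the same universe on both sides. -/
theorem theorem3 (L : AffineIntegration.LipschitzLanguage.{u, v})
    (T : AffineIntegration.Theory L)
    (hT : AffineIntegration.Theory.AffinelySatisfiable.{u, v, w} T) :
    AffineIntegration.Theory.Satisfiable.{u, v, max u v w} T :=
  AffineIntegration.Theory.AffinelySatisfiable.satisfiable hT
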